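/- Let $\bar\Phi(s)=\Pr[g\ge s]$ for $g\sim\mathcal N(0,1)$, and let $\mathbf r$ be a random vector in $\mathbb R^d$ with independent $\mathcal N(0,1)$ entries. Let $X\subset\mathbb R^d$ be a set of unit vectors, $\mu$ a measure on $X$, and $s,\delta\in\mathbb R$. The pair $(X,\mu)$ is an $(s,\delta)$-packing if $\mu(X')\le\Pr[\exists\,\mathbf x\in X':\ \mathbf r\cdot\mathbf x\ge s]$ for every $X'\subseteq X$, and $\mu(X)\ge\delta$. It is $c$-inefficient if $X$ is finite and $|X|\le\bar\Phi(s)^{-(1+c)}$. For a set $V$ of unit vectors and $\lambda,p>0$, it is $(\lambda,p,V)$-spread if $\mu(\{\mathbf x\in X:\ \mathbf v\cdot\mathbf x\ge\lambda\})\le p$ for every $\mathbf v\in V$. There is an absolute constant $K>0$, and for every $c>0$ there are constants $c_1,c_2>0$ and $s_0>1$ depending only on $c$, such that the following holds for every $s\ge s_0$, every dimension $d$ and all $\delta_1,\delta_2\in\mathbb R$. For $i=1,2$ let $(X_i,\mu_i)$ be a $c$-inefficient $(s,\delta_i)$-packing in $\mathbb R^d$. Then there exists $X_1'\subseteq X_1$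 such that (1) $(X_1',\mu_1)$ (with $\mu_1$ restricted to $X_1'$) is an $\left(s,\ \delta_1-\frac{K}{\log s}\right)$-packing; (2) $(X_2,\mu_2)$ is $\left(\frac{c}{1+c}\left(1+\frac{c_1}{\log s}\right),\ \exp(-c_2\log^2 s),\ X_1'\cup(-X_1')\right)$-spread, where $-X_1'=\{-\mathbf v:\ \mathbf v\in X_1'\}$. -/

import Mathlib

open MeasureTheory ProbabilityTheory
open scoped Pointwise

/-- The Gaussian tail probability `1 - Φ(t)`, where `Φ` is the distribution function of the
standard normal law on the real line. -/
noncomputable def gaussianTail (t : ℝ) : ℝ :=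
  1 - cdf (gaussianReal 0 1) t

/-- The probability that some `x ∈ X` satisfies `r · x ≥ s`, where `r` is a standard Gaussian
random vector in `ℝ^d` (independent standard normal coordinates). -/
noncomputable def coverProb {d : ℕ} (s : ℝ) (X : Set (EuclideanSpace ℝ (Fin d))) : ENNReal :=
  stdGaussian (EuclideanSpace ℝ (Fin d)) {r | ∃ x ∈ X, s ≤ inner ℝ r x}

/-- `(X, μ)` is an `(s, δ)`-packing. The measure `μ` is carried by the ambient space; only its
values on subsets of `X` play a role, so that the same `μ` serves for all subsets of `X`. -/
structure IsPacking {d : ℕ} (s δ : ℝ) (X : Set (EuclideanSpace ℝ (Fin d)))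
    (μ : Measure (EuclideanSpace ℝ (Fin d))) : Prop where
  norm_eq_one : ∀ x ∈ X, ‖x‖ = 1
  le_coverProb : ∀ X' ⊆ X, μ X' ≤ coverProb s X'
  le_measure : ENNReal.ofReal δ ≤ μ X

/-- `X` is (at most) `c`-inefficient with respect to `s`: it is finite and has at most
`(1 - Φ(s)) ^ (-(1 + c))` elements. -/
def IsInefficient {d : ℕ} (c s : ℝ) (X : Set (EuclideanSpace ℝ (Fin d))) : Prop :=
  X.Finite ∧ (X.ncard : ℝ) ≤ gaussianTail s ^ (-(1 + c))

/-- `(X, μ)` is `(l, p, V)`-spread: for every `v ∈ V`, the vectors `x ∈ X` with `v · x ≥ l` have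
measure at most `p`. -/
def IsSpread {d : ℕ} (l p : ℝ) (V X : Set (EuclideanSpace ℝ (Fin d)))
    (μ : Measure (EuclideanSpace ℝ (Fin d))) : Prop :=
  ∀ v ∈ V, μ {x ∈ X | l ≤ inner ℝ v x} ≤ ENNReal.ofReal p

/-! By the packing property and inefficiency, every cap of height `θ` slightly above `√(c / (1 +
c))` has tiny mass `q`, of order `exp (-s / 2)` (`IsPacking.measure_cap_le`, `cap_exponent_le`).
Indeed a Gaussian rarely reaches `√s` in the direction of the cap, and the orthogonal components
have variance at most `1 - θ ^ 2`, small enough for a union bound over the cap.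

If too many `v ∈ X₁` saw a `p`-fraction of `X₂` at height `l = c / (1 + c) + 2 / log s`, the
resulting dense bipartite graph would allow a greedy choice of `m ≈ log² s` vectors of `X₁` with
many common neighbours in `X₂` (`sum_heavy_lt`). Each new vector avoids the cap around the current
sum `S`, so `‖S‖ ≤ θ m + √m`. Common neighbours have inner product at least `l m > θ ‖S‖` with `S`,
so they lie in one cap, yet their mass exceeds `q`: a contradiction. Deleting the heavy vectors for
both signs from `X₁` gives the theorem. -/

/-! ### Greedy choice in a dense bipartite graph -/

section Greedy

variable {E ι κ : Type*} [NormedAddCommGroup E] [InnerProductSpace ℝ E]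

/-- One greedy step: if every `j ∈ T` has `a`-degree at least `η`, some `i` avoids the cap around
`S` and has a neighbourhood of `b`-mass at least `η / 2` times that of `T`. -/
lemma exists_mem_inner_le_and_half_mul_sum_le (A : Finset ι) (T : Finset κ) (f : ι → E) (g : κ → E)
    (a : ι → ℝ) (b : κ → ℝ) (ha : ∀ i, 0 ≤ a i) (hb : ∀ j, 0 ≤ b j) (hA : ∑ i ∈ A, a i ≤ 1)
    {θ l q η : ℝ} (S : E) (hcap : ∑ i ∈ A with θ * ‖S‖ < inner ℝ (f i) S, a i ≤ q)
    (hq : q < η / 2) (hη : 0 < η)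
    (hdeg : ∀ j ∈ T, η ≤ ∑ i ∈ A with l ≤ inner ℝ (f i) (g j), a i) (hT : 0 < ∑ j ∈ T, b j) :
    ∃ i ∈ A, inner ℝ (f i) S ≤ θ * ‖S‖ ∧
      η / 2 * ∑ j ∈ T, b j ≤ ∑ j ∈ T with l ≤ inner ℝ (f i) (g j), b j := by
  -- Double counting: the edge mass is at least `η W`, but vectors in the cap contribute at most `q
  -- W` and the others at most `η / 2 * W`.
  by_contra! hcon
  set W := ∑ j ∈ T, b j with hW
  have h1 : η * W ≤ ∑ i ∈ A, a i * ∑ j ∈ T with l ≤ inner ℝ (f i) (g j), b j := by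
    calc η * W = ∑ j ∈ T, η * b j := by rw [hW, Finset.mul_sum]
      _ ≤ ∑ j ∈ T, (∑ i ∈ A with l ≤ inner ℝ (f i) (g j), a i) * b j :=
        Finset.sum_le_sum fun j hj => mul_le_mul_of_nonneg_right (hdeg j hj) (hb j)
      _ = ∑ j ∈ T, ∑ i ∈ A, if l ≤ inner ℝ (f i) (g j) then a i * b j else 0 := by
        refine Finset.sum_congr rfl fun j _ => ?_
        rw [Finset.sum_mul, Finset.sum_filter]
      _ = ∑ i ∈ A, a i * ∑ j ∈ T with l ≤ inner ℝ (f i) (g j), b j := by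
        rw [Finset.sum_comm]
        refine Finset.sum_congr rfl fun i _ => ?_
        rw [Finset.mul_sum, Finset.sum_filter]
  have h2 : ∑ i ∈ A with θ * ‖S‖ < inner ℝ (f i) S,
      a i * ∑ j ∈ T with l ≤ inner ℝ (f i) (g j), b j ≤ q * W := by
    refine le_trans (Finset.sum_le_sum fun i _ => mul_le_mul_of_nonneg_left
      (Finset.sum_le_sum_of_subset_of_nonneg (Finset.filter_subset _ _) fun j _ _ => hb j)
      (ha i)) ?_
    rw [← Finset.sum_mul]
    exact mul_le_mul_of_nonneg_right hcap hT.le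
  have h3 : ∑ i ∈ A with ¬ θ * ‖S‖ < inner ℝ (f i) S,
      a i * ∑ j ∈ T with l ≤ inner ℝ (f i) (g j), b j ≤ η / 2 * W := by
    calc _ ≤ ∑ i ∈ A with ¬ θ * ‖S‖ < inner ℝ (f i) S, a i * (η / 2 * W) := by
          refine Finset.sum_le_sum fun i hi => mul_le_mul_of_nonneg_left ?_ (ha i)
          rw [Finset.mem_filter] at hi
          exact (hcon i hi.1 (not_lt.1 hi.2)).le
      _ = (∑ i ∈ A with ¬ θ * ‖S‖ < inner ℝ (f i) S, a i) * (η / 2 * W) := by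
          rw [Finset.sum_mul]
      _ ≤ 1 * (η / 2 * W) := by
          refine mul_le_mul_of_nonneg_right ?_ (by positivity)
          exact (Finset.sum_le_sum_of_subset_of_nonneg (Finset.filter_subset _ _)
            fun i _ _ => ha i).trans hA
      _ = η / 2 * W := one_mul _
  have h4 := Finset.sum_filter_add_sum_filter_not A (fun i => θ * ‖S‖ < inner ℝ (f i) S)
    fun i => a i * ∑ j ∈ T with l ≤ inner ℝ (f i) (g j), b j
  nlinarith

/-- The linear term grows by `θ` per step because the new vector avoids the cap around `S`; the unit
squared lengths accumulate only to `√k`. -/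
lemma norm_add_le_of_inner_le {v S : E} {θ : ℝ} (hθ : 0 ≤ θ) (hv : ‖v‖ ≤ 1) (k : ℕ)
    (hS : ‖S‖ ≤ θ * k + √k) (hvS : inner ℝ v S ≤ θ * ‖S‖) :
    ‖S + v‖ ≤ θ * (k + 1 : ℕ) + √(k + 1 : ℕ) := by
  have hk : √(k : ℝ) ≤ √((k + 1 : ℕ) : ℝ) := Real.sqrt_le_sqrt (by push_cast; linarith)
  have e1 : √(k : ℝ) ^ 2 = k := Real.sq_sqrt (by positivity)
  have e2 : √((k + 1 : ℕ) : ℝ) ^ 2 = k + 1 := by rw [Real.sq_sqrt (by positivity)]; push_cast; ring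
  have h0 : 0 ≤ √(k : ℝ) := Real.sqrt_nonneg _
  have h1 : 0 ≤ √((k + 1 : ℕ) : ℝ) := Real.sqrt_nonneg _
  refine (sq_le_sq₀ (norm_nonneg _) (by positivity)).1 ?_
  have hn : ‖S + v‖ ^ 2 = ‖S‖ ^ 2 + 2 * inner ℝ v S + ‖v‖ ^ 2 := by
    rw [norm_add_sq_real, real_inner_comm]
  have hS2 : ‖S‖ ^ 2 ≤ (θ * k + √k) ^ 2 := by gcongr
  have hv2 : ‖v‖ ^ 2 ≤ 1 := by nlinarith [norm_nonneg v]
  have h3 : θ * ‖S‖ ≤ θ * (θ * k + √k) := by gcongr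
  have h4 : θ * (k + 1) * √(k : ℝ) ≤ θ * (k + 1) * √((k + 1 : ℕ) : ℝ) := by gcongr
  rw [hn]
  push_cast at *
  nlinarith [sq_nonneg θ]

/-- Iterates the greedy step: `S` is the sum of the chosen vectors and `T'` their common
neighbourhood. -/
lemma exists_norm_le_and_pow_mul_sum_le (A : Finset ι) (T : Finset κ) (f : ι → E) (g : κ → E)
    (a : ι → ℝ) (b : κ → ℝ) (ha : ∀ i, 0 ≤ a i) (hb : ∀ j, 0 ≤ b j) (hA : ∑ i ∈ A, a i ≤ 1)
    (hf : ∀ i ∈ A, ‖f i‖ ≤ 1) {θ l q η : ℝ} (hθ : 0 ≤ θ)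
    (hcap : ∀ S, ∑ i ∈ A with θ * ‖S‖ < inner ℝ (f i) S, a i ≤ q)
    (hq : q < η / 2) (hη : 0 < η)
    (hdeg : ∀ j ∈ T, η ≤ ∑ i ∈ A with l ≤ inner ℝ (f i) (g j), a i) (hT : 0 < ∑ j ∈ T, b j)
    (m : ℕ) :
    ∃ S : E, ∃ T' ⊆ T, ‖S‖ ≤ θ * m + √m ∧ (∀ j ∈ T', l * m ≤ inner ℝ (g j) S) ∧
      (η / 2) ^ m * ∑ j ∈ T, b j ≤ ∑ j ∈ T', b j := by
  induction m with
  | zero => exact ⟨0, T, subset_rfl, by simp, by simp, by simp⟩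
  | succ k ih =>
    obtain ⟨S, T', hTT, hS, hin, hsum⟩ := ih
    have hpos : 0 < ∑ j ∈ T', b j := lt_of_lt_of_le (by positivity) hsum
    obtain ⟨i, hi, hiS, hiT⟩ := exists_mem_inner_le_and_half_mul_sum_le A T' f g a b ha hb hA S
      (hcap S) hq hη (fun j hj => hdeg j (hTT hj)) hpos
    refine ⟨S + f i, T'.filter fun j => l ≤ inner ℝ (f i) (g j), (Finset.filter_subset _ _).trans hTT,
      norm_add_le_of_inner_le hθ (hf i hi) k hS hiS, fun j hj => ?_, ?_⟩
    rotate_left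
    · refine le_trans ?_ hiT
      rw [pow_succ']
      calc _ = η / 2 * ((η / 2) ^ k * ∑ j ∈ T, b j) := by ring
        _ ≤ _ := by gcongr
    · rw [Finset.mem_filter] at hj
      have := hin j hj.1
      rw [inner_add_right, real_inner_comm (f i)]
      push_cast
      linarith [hj.2]

/-- If both weighted families have little mass in every cap of height `θ`, then the `f i` that see
a `p`-fraction of the `g j` at height `l > θ ^ 2 + θ / √m` have total mass less than `p'`. -/
lemma sum_heavy_lt (A : Finset ι) (B : Finset κ) (f : ι → E) (g : κ → E)
    (a : ι → ℝ) (b : κ → ℝ) (ha : ∀ i, 0 ≤ a i) (hb : ∀ j, 0 ≤ b j) (hA : ∑ i ∈ A, a i ≤ 1)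
    (hB : ∑ j ∈ B, b j ≤ 1) (hf : ∀ i ∈ A, ‖f i‖ ≤ 1) {θ l q p p' : ℝ} (hθ : 0 ≤ θ)
    (hcapA : ∀ S, ∑ i ∈ A with θ * ‖S‖ < inner ℝ (f i) S, a i ≤ q)
    (hcapB : ∀ S, ∑ j ∈ B with θ * ‖S‖ < inner ℝ (g j) S, b j ≤ q)
    (hp : 0 < p) (hp' : 0 < p') (hpp : p * p' ≤ 1) {m : ℕ} (hm : m ≠ 0)
    (hl : θ ^ 2 * m + θ * √m < l * m) (hq : q < (p * p' / 4) ^ m * (p * p' / 2)) :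
    ∑ i ∈ A with p ≤ ∑ j ∈ B with l ≤ inner ℝ (f i) (g j), b j, a i < p' := by
  by_contra! hcon
  set η := p * p' / 2 with hη
  have hη0 : 0 < η := by positivity
  have hdp : η / 2 = p * p' / 4 := by rw [hη]; ring
  rw [← hdp] at hq
  have hq2 : q < η / 2 := by
    refine hq.trans_le ?_
    calc (η / 2) ^ m * η ≤ (η / 2) ^ 1 * 1 := by
          gcongr ?_ * ?_
          · exact pow_le_pow_of_le_one (by positivity) (by linarith) (Nat.one_le_iff_ne_zero.2 hm)
          · linarith
      _ = η / 2 := by ring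
  set D : κ → ℝ := fun j => ∑ i ∈ A with l ≤ inner ℝ (f i) (g j), a i with hD
  have hD1 : ∀ j, D j ≤ 1 := fun j =>
    (Finset.sum_le_sum_of_subset_of_nonneg (Finset.filter_subset _ _) fun i _ _ => ha i).trans hA
  have htot : 2 * η ≤ ∑ j ∈ B, D j * b j := by
    calc 2 * η = p' * p := by rw [hη]; ring
      _ ≤ (∑ i ∈ A with p ≤ ∑ j ∈ B with l ≤ inner ℝ (f i) (g j), b j, a i) * p := by gcongr
      _ ≤ ∑ i ∈ A with p ≤ ∑ j ∈ B with l ≤ inner ℝ (f i) (g j), b j,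
          a i * ∑ j ∈ B with l ≤ inner ℝ (f i) (g j), b j := by
        rw [Finset.sum_mul]
        refine Finset.sum_le_sum fun i hi => mul_le_mul_of_nonneg_left ?_ (ha i)
        exact (Finset.mem_filter.1 hi).2
      _ ≤ ∑ i ∈ A, a i * ∑ j ∈ B with l ≤ inner ℝ (f i) (g j), b j :=
        Finset.sum_le_sum_of_subset_of_nonneg (Finset.filter_subset _ _) fun i _ _ =>
          mul_nonneg (ha i) (Finset.sum_nonneg fun j _ => hb j)
      _ = ∑ i ∈ A, ∑ j ∈ B, if l ≤ inner ℝ (f i) (g j) then a i * b j else 0 := by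
        refine Finset.sum_congr rfl fun i _ => ?_
        rw [Finset.mul_sum, Finset.sum_filter]
      _ = ∑ j ∈ B, D j * b j := by
        rw [Finset.sum_comm]
        refine Finset.sum_congr rfl fun j _ => ?_
        rw [hD, Finset.sum_mul, Finset.sum_filter]
  -- Markov-type averaging: degrees are at most 1 and the total edge mass is at least `2 * η`.
  have hT : η ≤ ∑ j ∈ B with η ≤ D j, b j := by
    have h1 := Finset.sum_filter_add_sum_filter_not B (fun j => η ≤ D j) fun j => D j * b j
    have h2 : ∑ j ∈ B with η ≤ D j, D j * b j ≤ ∑ j ∈ B with η ≤ D j, b j :=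
      Finset.sum_le_sum fun j _ => mul_le_of_le_one_left (hb j) (hD1 j)
    have h3 : ∑ j ∈ B with ¬ η ≤ D j, D j * b j ≤ η := by
      calc _ ≤ ∑ j ∈ B with ¬ η ≤ D j, η * b j :=
            Finset.sum_le_sum fun j hj => mul_le_mul_of_nonneg_right
              (not_le.1 (Finset.mem_filter.1 hj).2).le (hb j)
        _ = η * ∑ j ∈ B with ¬ η ≤ D j, b j := by rw [Finset.mul_sum]
        _ ≤ η * 1 := by
            gcongr
            exact (Finset.sum_le_sum_of_subset_of_nonneg (Finset.filter_subset _ _)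
              fun j _ _ => hb j).trans hB
        _ = η := mul_one _
    linarith
  obtain ⟨S, T', hT', hS, hin, hsum⟩ := exists_norm_le_and_pow_mul_sum_le A
    (B.filter fun j => η ≤ D j) f g a b ha hb hA hf hθ hcapA hq2 hη0
    (fun j hj => (Finset.mem_filter.1 hj).2) (hη0.trans_le hT) m
  have hsub : T' ⊆ B.filter fun j => θ * ‖S‖ < inner ℝ (g j) S := by
    intro j hj
    refine Finset.mem_filter.2 ⟨(Finset.mem_filter.1 (hT' hj)).1, ?_⟩
    calc θ * ‖S‖ ≤ θ * (θ * m + √m) := by gcongr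
      _ < l * m := by linarith
      _ ≤ _ := hin j hj
  have h5 := (Finset.sum_le_sum_of_subset_of_nonneg hsub fun j _ _ => hb j).trans (hcapB S)
  have h6 : (η / 2) ^ m * η ≤ (η / 2) ^ m * ∑ j ∈ B with η ≤ D j, b j := by gcongr
  linarith

end Greedy

/-! ### Gaussian tails and the mass of caps -/

/-- Keep only the density on `(s, s + 1]`; the passage from `s + 1` to `s + 2` absorbs `√(2π) < e`.
-/
lemma exp_le_gaussianTail {s : ℝ} (hs : 0 ≤ s) :
    Real.exp (-((s + 2) ^ 2 / 2)) ≤ gaussianTail s := by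
  have h1 : gaussianTail s = (gaussianReal 0 1).real (Set.Ioi s) := by
    rw [gaussianTail, cdf_eq_real, ← Set.compl_Iic, probReal_compl_eq_one_sub measurableSet_Iic]
  have h2 : (gaussianReal 0 1).real (Set.Ioi s) = ∫ x in Set.Ioi s, gaussianPDFReal 0 1 x := by
    rw [measureReal_def, gaussianReal_apply_eq_integral _ one_ne_zero, ENNReal.toReal_ofReal]
    exact integral_nonneg fun x => gaussianPDFReal_nonneg _ _ _
  have h3 : ∫ x in Set.Ioc s (s + 1), gaussianPDFReal 0 1 x
      ≤ ∫ x in Set.Ioi s, gaussianPDFReal 0 1 x :=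
    setIntegral_mono_set (integrable_gaussianPDFReal _ _).integrableOn
      (ae_of_all _ fun x => gaussianPDFReal_nonneg _ _ _) (ae_of_all _ Set.Ioc_subset_Ioi_self)
  have h4 : ∫ x in Set.Ioc s (s + 1), Real.exp (-((s + 2) ^ 2 / 2))
      ≤ ∫ x in Set.Ioc s (s + 1), gaussianPDFReal 0 1 x := by
    refine setIntegral_mono_on (by simp) (integrable_gaussianPDFReal _ _).integrableOn
      measurableSet_Ioc fun x hx => ?_
    have hpi : √(2 * Real.pi) ≤ 2.6 := by
      rw [Real.sqrt_le_left (by norm_num)]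
      nlinarith [Real.pi_lt_d2]
    have hpi0 : 0 < √(2 * Real.pi) := Real.sqrt_pos.2 (by positivity)
    have hx2 : x ^ 2 ≤ (s + 1) ^ 2 := by
      have := hx.1
      exact pow_le_pow_left₀ (by linarith) hx.2 2
    have he : (2.6 : ℝ) ≤ Real.exp 1 := by linarith [Real.exp_one_gt_d9]
    have h5 : Real.exp (-((s + 2) ^ 2 / 2)) * √(2 * Real.pi) ≤ Real.exp (-(x ^ 2 / 2)) := by
      calc _ ≤ Real.exp (-((s + 2) ^ 2 / 2)) * Real.exp 1 := by gcongr; linarith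
        _ = Real.exp (-((s + 2) ^ 2 / 2) + 1) := by rw [Real.exp_add]
        _ ≤ _ := Real.exp_le_exp.2 (by nlinarith)
    rw [gaussianPDFReal_def]
    simp only [NNReal.coe_one, mul_one, sub_zero]
    rw [inv_mul_eq_div, le_div_iff₀ hpi0, neg_div]
    exact h5
  have h6 : ∫ x in Set.Ioc s (s + 1), Real.exp (-((s + 2) ^ 2 / 2)) = Real.exp (-((s + 2) ^ 2 / 2)) := by
    simp
  linarith

lemma IsInefficient.ncard_le_exp {d : ℕ} {c s : ℝ} {X : Set (EuclideanSpace ℝ (Fin d))}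
    (h : IsInefficient c s X) (hc : 0 < c) (hs : 0 ≤ s) :
    (X.ncard : ℝ) ≤ Real.exp ((1 + c) * (s + 2) ^ 2 / 2) := by
  refine h.2.trans ?_
  calc gaussianTail s ^ (-(1 + c)) ≤ Real.exp (-((s + 2) ^ 2 / 2)) ^ (-(1 + c)) :=
        Real.rpow_le_rpow_of_nonpos (Real.exp_pos _) (exp_le_gaussianTail hs) (by linarith)
    _ = Real.exp ((1 + c) * (s + 2) ^ 2 / 2) := by
        rw [← Real.exp_mul]
        congr 1
        ring

section Tail

variable {E : Type*} [NormedAddCommGroup E] [InnerProductSpace ℝ E] [FiniteDimensional ℝ E]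
  [MeasurableSpace E] [BorelSpace E]

lemma map_inner_stdGaussian (y : E) :
    (stdGaussian E).map (fun r => inner ℝ r y) = gaussianReal 0 (‖y‖ ^ 2).toNNReal := by
  have h := IsGaussian.map_eq_gaussianReal (μ := stdGaussian E) (innerSL ℝ y)
  rw [integral_strongDual_stdGaussian, variance_dual_stdGaussian, innerSL_apply_norm] at h
  rw [← h]
  congr 1
  ext r
  rw [innerSL_apply_apply, real_inner_comm]

lemma stdGaussian_real_le_inner_le (y : E) {a V : ℝ} (ha : 0 ≤ a) (hV : 0 < V)
    (hy : ‖y‖ ^ 2 ≤ V) :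
    (stdGaussian E).real {r | a ≤ inner ℝ r y} ≤ Real.exp (-(a ^ 2 / (2 * V))) := by
  have hmeas : AEMeasurable (fun r : E => inner ℝ r y) (stdGaussian E) := by fun_prop
  have hint : Integrable (fun r : E => Real.exp (a / V * inner ℝ r y)) (stdGaussian E) := by
    have := integrable_exp_mul_gaussianReal (μ := 0) (v := (‖y‖ ^ 2).toNNReal) (a / V)
    rw [← map_inner_stdGaussian y] at this
    exact this.comp_aemeasurable hmeas
  refine (measure_ge_le_exp_mul_mgf a (t := a / V) (by positivity) hint).trans ?_
  rw [mgf_gaussianReal (map_inner_stdGaussian y), ← Real.exp_add, Real.exp_le_exp,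
    Real.coe_toNNReal _ (by positivity)]
  calc -(a / V) * a + (0 * (a / V) + ‖y‖ ^ 2 * (a / V) ^ 2 / 2)
      ≤ -(a / V) * a + (0 * (a / V) + V * (a / V) ^ 2 / 2) := by gcongr
    _ = -(a ^ 2 / (2 * V)) := by field_simp; ring

end Tail

/-- Finitely many unit vectors in a cap of height `θ` around `u` are jointly unlikely to reach
level `s`: either `u` reaches level `t`, or some component orthogonal to `u` reaches `s - t`. -/
lemma coverProb_cap_le {d : ℕ} {s t θ : ℝ} {Y : Set (EuclideanSpace ℝ (Fin d))} (hY : Y.Finite)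
    (h1 : ∀ x ∈ Y, ‖x‖ = 1) {u : EuclideanSpace ℝ (Fin d)} (hu : ‖u‖ = 1) (ht : 0 ≤ t)
    (hts : t ≤ s) (hθ : 0 ≤ θ) (hθ1 : θ ^ 2 < 1) (hYu : ∀ x ∈ Y, θ ≤ inner ℝ x u) :
    coverProb s Y ≤ ENNReal.ofReal (Real.exp (-(t ^ 2 / 2)) +
      Y.ncard * Real.exp (-((s - t) ^ 2 / (2 * (1 - θ ^ 2))))) := by
  set F := hY.toFinset with hF
  set P : Measure (EuclideanSpace ℝ (Fin d)) := stdGaussian (EuclideanSpace ℝ (Fin d)) with hP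
  rw [coverProb, ENNReal.le_ofReal_iff_toReal_le (measure_ne_top _ _) (by positivity),
    ← measureReal_def]
  have hsub : {r : EuclideanSpace ℝ (Fin d) | ∃ x ∈ Y, s ≤ inner ℝ r x} ⊆ {r | t ≤ inner ℝ r u} ∪
      ⋃ x ∈ F, {r | s - t ≤ inner ℝ r (x - (inner ℝ x u : ℝ) • u)} := by
    rintro r ⟨x, hx, hr⟩
    by_cases hru : t ≤ inner ℝ r u
    · exact Or.inl hru
    refine Or.inr (Set.mem_iUnion₂.2 ⟨x, hY.mem_toFinset.2 hx, ?_⟩)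
    -- Since `0 ≤ x · u ≤ 1` and `r · u < t` with `t ≥ 0`, the component along `u` contributes at
    -- most `t`.
    have hx1 : (inner ℝ x u : ℝ) ≤ 1 := by
      have := real_inner_le_norm x u
      rwa [h1 x hx, hu, one_mul] at this
    have hx0 := hθ.trans (hYu x hx)
    simp only [Set.mem_ofPred_eq, inner_sub_right, inner_smul_right]
    push Not at hru
    nlinarith
  have hone : P.real {r | t ≤ inner ℝ r u} ≤ Real.exp (-(t ^ 2 / 2)) := by
    simpa using stdGaussian_real_le_inner_le u ht one_pos (by rw [hu]; norm_num)
  have htwo : ∀ x ∈ F, P.real {r | s - t ≤ inner ℝ r (x - (inner ℝ x u : ℝ) • u)}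
      ≤ Real.exp (-((s - t) ^ 2 / (2 * (1 - θ ^ 2)))) := by
    intro x hx
    rw [hY.mem_toFinset] at hx
    refine stdGaussian_real_le_inner_le _ (by linarith) (by linarith) ?_
    rw [norm_sub_sq_real, inner_smul_right, norm_smul, h1 x hx, hu, mul_one, Real.norm_eq_abs,
      sq_abs]
    nlinarith [hYu x hx]
  calc P.real {r | ∃ x ∈ Y, s ≤ inner ℝ r x}
      ≤ P.real ({r | t ≤ inner ℝ r u} ∪
        ⋃ x ∈ F, {r | s - t ≤ inner ℝ r (x - (inner ℝ x u : ℝ) • u)}) :=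
        measureReal_mono hsub
    _ ≤ P.real {r | t ≤ inner ℝ r u} +
        P.real (⋃ x ∈ F, {r | s - t ≤ inner ℝ r (x - (inner ℝ x u : ℝ) • u)}) :=
        measureReal_union_le _ _
    _ ≤ Real.exp (-(t ^ 2 / 2)) +
        ∑ x ∈ F, P.real {r | s - t ≤ inner ℝ r (x - (inner ℝ x u : ℝ) • u)} :=
        add_le_add hone (measureReal_biUnion_finset_le _ _)
    _ ≤ _ := by
        gcongr
        refine (Finset.sum_le_sum htwo).trans ?_
        rw [Finset.sum_const, nsmul_eq_mul, Set.ncard_eq_toFinset_card _ hY]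

lemma IsPacking.measure_cap_le {d : ℕ} {c s δ t θ : ℝ} {X : Set (EuclideanSpace ℝ (Fin d))}
    {μ : Measure (EuclideanSpace ℝ (Fin d))} (h : IsPacking s δ X μ) (hX : IsInefficient c s X)
    (hc : 0 < c) (ht : 0 ≤ t) (hts : t ≤ s) (hθ : 0 ≤ θ) (hθ1 : θ ^ 2 < 1)
    (w : EuclideanSpace ℝ (Fin d)) :
    μ {x ∈ X | θ * ‖w‖ < inner ℝ x w} ≤ ENNReal.ofReal (Real.exp (-(t ^ 2 / 2)) +
      Real.exp ((1 + c) * (s + 2) ^ 2 / 2 - (s - t) ^ 2 / (2 * (1 - θ ^ 2)))) := by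
  -- The strict inequality makes the cap around `0` empty, so the greedy process can start at `S =
  -- 0`.
  rcases eq_or_ne w 0 with rfl | hw
  · simp
  have hw0 : 0 < ‖w‖ := norm_pos_iff.2 hw
  have hsub : {x ∈ X | θ * ‖w‖ < inner ℝ x w} ⊆ X := Set.sep_subset _ _
  refine (h.le_coverProb _ hsub).trans ((coverProb_cap_le (u := ‖w‖⁻¹ • w) (hX.1.subset hsub)
    (fun x hx => h.norm_eq_one x hx.1) (by
      rw [norm_smul, norm_inv, norm_norm, inv_mul_cancel₀ hw0.ne']) ht hts hθ hθ1
    fun x hx => ?_).trans ?_)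
  · rw [inner_smul_right, inv_mul_eq_div, le_div_iff₀ hw0]
    exact hx.2.le
  · refine ENNReal.ofReal_le_ofReal ?_
    rw [sub_eq_add_neg (_ / 2), Real.exp_add]
    gcongr
    refine le_trans ?_ (hX.ncard_le_exp hc (ht.trans hts))
    exact_mod_cast Set.ncard_le_ncard hsub hX.1

/-- At `θ ^ 2 = c / (1 + c)` the union bound just breaks even, as `1 / (1 - θ ^ 2) = 1 + c`; the
extra `1 / L` gains a factor `1 + 1 / L`. -/
lemma one_div_one_sub_add_ge {c L : ℝ} (hc : 0 < c) (hL : 1 + c < L) :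
    (1 + c) * (1 + 1 / L) ≤ 1 / (1 - (c / (1 + c) + 1 / L)) := by
  have hL0 : 0 < L := by linarith
  have h1 : 1 - (c / (1 + c) + 1 / L) = (L - (1 + c)) / ((1 + c) * L) := by
    field_simp
    ring
  rw [h1, one_div_div, le_div_iff₀ (by linarith)]
  have h2 : (1 + c) * (1 + 1 / L) * (L - (1 + c)) = (1 + c) * L - (1 + c) * (c + (1 + c) / L) := by
    field_simp
    ring
  have : 0 < (1 + c) / L := by positivity
  rw [h2]
  nlinarith

/-- With `r = √s`, replacing `s - r` by `s + 2` costs about `2 r ^ 3`, while the factor `1 + 1 / L`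
gains at least `12 r (r - 1) ^ 2`. -/
lemma cap_exponent_le {c s : ℝ} (hc : 0 < c) (h8 : 8 ≤ Real.log s) (hcL : 1 + c < Real.log s)
    (h12 : 12 * Real.log s ≤ √s) :
    (1 + c) * (s + 2) ^ 2 / 2 - (s - √s) ^ 2 / (2 * (1 - (c / (1 + c) + 1 / Real.log s)))
      ≤ -(s / 2) := by
  set L := Real.log s with hL
  set r := √s with hr
  have hL0 : 0 < L := by linarith
  have hs : s = r ^ 2 := by
    refine (Real.sq_sqrt (le_of_lt ?_)).symm
    exact Real.sqrt_pos.1 (by linarith)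
  have h1 : (s - r) ^ 2 * ((1 + c) * (1 + 1 / L)) / 2
      ≤ (s - r) ^ 2 / (2 * (1 - (c / (1 + c) + 1 / L))) := by
    calc _ ≤ (s - r) ^ 2 * (1 / (1 - (c / (1 + c) + 1 / L))) / 2 := by
          have := one_div_one_sub_add_ge hc hcL
          gcongr
      _ = _ := by rw [mul_one_div, div_div, mul_comm 2]
  have h2 : 12 / r ≤ 1 / L := by
    rw [div_le_div_iff₀ (by linarith) hL0]
    linarith
  have h3 : (s - r) ^ 2 * (12 / r) ≤ (s - r) ^ 2 * (1 / L) := by gcongr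
  have h4 : (s - r) ^ 2 * (12 / r) = 12 * r * (r - 1) ^ 2 := by
    have : r ≠ 0 := by
      have : 0 < r := by linarith
      exact this.ne'
    rw [hs]
    field_simp
  have hr96 : 96 ≤ r := by linarith
  have h5 : (s + 2) ^ 2 - (s - r) ^ 2 * (1 + 1 / L) ≤ -s := by
    have h6 : 0 ≤ r * (r - 96) := by nlinarith
    have h7 : 0 ≤ r ^ 2 * (r - 96) := by
      have : 0 ≤ r - 96 := by linarith
      positivity
    have : (s + 2) ^ 2 - (s - r) ^ 2 = 2 * r ^ 3 + 3 * r ^ 2 + 4 := by rw [hs]; ring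
    have : 12 * r * (r - 1) ^ 2 = 12 * r ^ 3 - 24 * r ^ 2 + 12 * r := by ring
    nlinarith
  have hs0 : 0 ≤ s := by rw [hs]; positivity
  calc _ ≤ (1 + c) * (s + 2) ^ 2 / 2 - (s - r) ^ 2 * ((1 + c) * (1 + 1 / L)) / 2 := by linarith
    _ = (1 + c) / 2 * ((s + 2) ^ 2 - (s - r) ^ 2 * (1 + 1 / L)) := by ring
    _ ≤ (1 + c) / 2 * (-s) := by gcongr
    _ ≤ _ := by nlinarith

/-- The right side is at least `exp (-2 L ^ 2)` to the power `⌈L ^ 2⌉₊ + 1`, hence at least `exp (-3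
L ^ 4)`, which beats `2 exp (-s / 2)`. -/
lemma cap_bound_lt {c s : ℝ} (hc : 0 < c) (hs : 1 < s) (h8 : 8 ≤ Real.log s)
    (hcL : 1 + c < Real.log s) (h12 : 12 * Real.log s ≤ √s)
    (h4 : 3 * Real.log s ^ 4 + 1 < s / 2) :
    Real.exp (-(√s ^ 2 / 2)) + Real.exp ((1 + c) * (s + 2) ^ 2 / 2 -
        (s - √s) ^ 2 / (2 * (1 - (c / (1 + c) + 1 / Real.log s)))) <
      (Real.exp (-Real.log s ^ 2) * (1 / (2 * Real.log s)) / 4) ^ ⌈Real.log s ^ 2⌉₊ *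
        (Real.exp (-Real.log s ^ 2) * (1 / (2 * Real.log s)) / 2) := by
  have hexp := cap_exponent_le hc h8 hcL h12
  set L := Real.log s with hL
  have hL0 : 0 < L := by linarith
  set η := Real.exp (-L ^ 2) * (1 / (2 * L)) / 4 with hη
  have hη1 : Real.exp (-(2 * L ^ 2)) ≤ η := by
    have h1 : 8 * L ≤ Real.exp (L ^ 2) := by nlinarith [Real.add_one_le_exp (L ^ 2)]
    have h2 : η = Real.exp (-L ^ 2) * (1 / (8 * L)) := by rw [hη]; field_simp; norm_num
    have h3 : Real.exp (-(2 * L ^ 2)) = Real.exp (-L ^ 2) * (1 / Real.exp (L ^ 2)) := by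
      rw [one_div, ← Real.exp_neg, ← Real.exp_add]
      ring_nf
    rw [h2, h3]
    gcongr
  have hη0 : 0 < η := by positivity
  have hm : (⌈L ^ 2⌉₊ : ℝ) < L ^ 2 + 1 := Nat.ceil_lt_add_one (by positivity)
  calc _ ≤ Real.exp (-(s / 2)) + Real.exp (-(s / 2)) := by
        rw [Real.sq_sqrt (by linarith)]
        gcongr
    _ = 2 * Real.exp (-(s / 2)) := by ring
    _ ≤ Real.exp 1 * Real.exp (-(s / 2)) := by
        gcongr
        linarith [Real.exp_one_gt_d9]
    _ = Real.exp (1 - s / 2) := by rw [← Real.exp_add]; ring_nf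
    _ < Real.exp ((⌈L ^ 2⌉₊ + 1 : ℕ) * -(2 * L ^ 2)) := by
        refine Real.exp_lt_exp.2 ?_
        push_cast
        have h5 : (⌈L ^ 2⌉₊ + 1 : ℝ) * (2 * L ^ 2) ≤ (L ^ 2 + 2) * (2 * L ^ 2) := by
          gcongr ?_ * _
          linarith
        have h6 : 0 ≤ L ^ 2 * (L ^ 2 - 4) := mul_nonneg (by positivity) (by nlinarith)
        linarith
    _ = Real.exp (-(2 * L ^ 2)) ^ (⌈L ^ 2⌉₊ + 1) := by rw [Real.exp_nat_mul]
    _ ≤ η ^ (⌈L ^ 2⌉₊ + 1) := by gcongr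
    _ = η ^ ⌈L ^ 2⌉₊ * η := pow_succ _ _
    _ ≤ _ := by
        refine mul_le_mul_of_nonneg_left ?_ (by positivity)
        have : 0 < Real.exp (-L ^ 2) * (1 / (2 * L)) := by positivity
        linarith

/-! ### Heavy vectors and the main theorem -/

lemma IsPacking.measure_le_one {d : ℕ} {s δ : ℝ} {X : Set (EuclideanSpace ℝ (Fin d))}
    {μ : Measure (EuclideanSpace ℝ (Fin d))} (h : IsPacking s δ X μ) : μ X ≤ 1 :=
  (h.le_coverProb X subset_rfl).trans prob_le_one

lemma sum_filter_restrict_real_singleton {α : Type*} [MeasurableSpace α]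
    [MeasurableSingletonClass α] {μ : Measure α} {X : Set α} (hX : X.Finite) (hμ : μ X ≤ 1)
    (p : α → Prop) [DecidablePred p] :
    ∑ x ∈ hX.toFinset with p x, (μ.restrict X).real {x} = μ.real {x ∈ X | p x} := by
  have : IsFiniteMeasure (μ.restrict X) :=
    ⟨by rw [Measure.restrict_apply_univ]; exact hμ.trans_lt ENNReal.one_lt_top⟩
  rw [sum_measureReal_singleton, measureReal_def, measureReal_def,
    Measure.restrict_eq_self _ (fun x hx => by simpa using (Finset.mem_filter.1 hx).1)]
  congr 2
  ext x
  simp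

/-- The `v ∈ X₁` for which a non-negligible part of `X₂` has inner product at least
`c / (1 + c) + 2 / log s` with `ε • v` have small measure. -/
lemma IsPacking.measure_heavy_le {d : ℕ} {c s δ₁ δ₂ ε : ℝ} {X₁ X₂ : Set (EuclideanSpace ℝ (Fin d))}
    {μ₁ μ₂ : Measure (EuclideanSpace ℝ (Fin d))} (h₁ : IsPacking s δ₁ X₁ μ₁)
    (hX₁ : IsInefficient c s X₁) (h₂ : IsPacking s δ₂ X₂ μ₂) (hX₂ : IsInefficient c s X₂)
    (hε : |ε| = 1) (hc : 0 < c) (hs : 1 < s) (h8 : 8 ≤ Real.log s)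
    (hcL : 1 + c < Real.log s) (h12 : 12 * Real.log s ≤ √s)
    (h4 : 3 * Real.log s ^ 4 + 1 < s / 2) :
    μ₁ {v ∈ X₁ | Real.exp (-Real.log s ^ 2) ≤
        μ₂.real {x ∈ X₂ | c / (1 + c) + 2 / Real.log s ≤ inner ℝ (ε • v) x}} ≤
      ENNReal.ofReal (1 / (2 * Real.log s)) := by
  have hlt := cap_bound_lt hc hs h8 hcL h12 h4
  set L := Real.log s with hL
  have hL0 : 0 < L := by linarith
  set θ := √(c / (1 + c) + 1 / L) with hθ
  have hθ2 : θ ^ 2 = c / (1 + c) + 1 / L := Real.sq_sqrt (by positivity)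
  have hθ1 : θ ^ 2 < 1 := by
    have : 1 / L < 1 / (1 + c) := by gcongr
    have : c / (1 + c) + 1 / (1 + c) = 1 := by field_simp; ring
    linarith
  have hθ1' : θ < 1 := by nlinarith [Real.sqrt_nonneg (c / (1 + c) + 1 / L)]
  rw [← hθ2] at hlt
  have hss : √s ≤ s := by
    rw [Real.sqrt_le_left (by linarith)]
    nlinarith
  have hcap₁ := h₁.measure_cap_le hX₁ hc (Real.sqrt_nonneg s) hss (Real.sqrt_nonneg _) hθ1
  have hcap₂ := h₂.measure_cap_le hX₂ hc (Real.sqrt_nonneg s) hss (Real.sqrt_nonneg _) hθ1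
  have hm0 : L ^ 2 ≤ (⌈L ^ 2⌉₊ : ℝ) := Nat.le_ceil _
  have hq0 : 0 ≤ Real.exp (-(√s ^ 2 / 2)) +
      Real.exp ((1 + c) * (s + 2) ^ 2 / 2 - (s - √s) ^ 2 / (2 * (1 - θ ^ 2))) := by positivity
  have key := sum_heavy_lt hX₁.1.toFinset hX₂.1.toFinset (fun v => ε • v) (fun x => x)
    (fun v => (μ₁.restrict X₁).real {v}) (fun x => (μ₂.restrict X₂).real {x})
    (fun _ => measureReal_nonneg) (fun _ => measureReal_nonneg)
    (l := c / (1 + c) + 2 / L) (θ := θ) (p := Real.exp (-L ^ 2)) (p' := 1 / (2 * L))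
    (m := ⌈L ^ 2⌉₊) ?_ ?_ ?_ (Real.sqrt_nonneg _) ?_ ?_ (by positivity) (by positivity) ?_ ?_ ?_ hlt
  · simp only [sum_filter_restrict_real_singleton _ h₂.measure_le_one,
      sum_filter_restrict_real_singleton _ h₁.measure_le_one] at key
    refine (ENNReal.le_ofReal_iff_toReal_le ?_ (by positivity)).2 key.le
    exact measure_ne_top_of_subset (Set.sep_subset _ _)
      (h₁.measure_le_one.trans_lt ENNReal.one_lt_top).ne
  · have := sum_filter_restrict_real_singleton hX₁.1 h₁.measure_le_one fun _ => True
    simp only [Finset.filter_true, and_true] at this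
    rw [this]
    exact ENNReal.toReal_le_of_le_ofReal zero_le_one (by simpa using h₁.measure_le_one)
  · have := sum_filter_restrict_real_singleton hX₂.1 h₂.measure_le_one fun _ => True
    simp only [Finset.filter_true, and_true] at this
    rw [this]
    exact ENNReal.toReal_le_of_le_ofReal zero_le_one (by simpa using h₂.measure_le_one)
  · intro v hv
    rw [norm_smul, Real.norm_eq_abs, hε, one_mul]
    exact (h₁.norm_eq_one v (hX₁.1.mem_toFinset.1 hv)).le
  · intro S
    rw [sum_filter_restrict_real_singleton _ h₁.measure_le_one]
    refine ENNReal.toReal_le_of_le_ofReal hq0 ?_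
    have := hcap₁ (ε • S)
    rwa [norm_smul, Real.norm_eq_abs, hε, one_mul, ← show
      {x ∈ X₁ | θ * ‖S‖ < inner ℝ (ε • x) S} = {x ∈ X₁ | θ * ‖S‖ < inner ℝ x (ε • S)} by
        simp only [real_inner_smul_left, real_inner_smul_right]] at this
  · intro S
    rw [sum_filter_restrict_real_singleton _ h₂.measure_le_one]
    exact ENNReal.toReal_le_of_le_ofReal hq0 (hcap₂ S)
  · have e1 : Real.exp (-L ^ 2) ≤ 1 := Real.exp_le_one_iff.2 (by nlinarith)
    have e2 : 1 / (2 * L) ≤ 1 := by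
      rw [div_le_one (by positivity)]
      linarith
    exact mul_le_one₀ e1 (by positivity) e2
  · exact (Nat.ceil_pos.2 (by positivity)).ne'
  · set m : ℝ := (⌈L ^ 2⌉₊ : ℝ) with hm
    have hm1 : 0 < m := by nlinarith
    have hLm : L ≤ √m := Real.le_sqrt_of_sq_le hm0
    -- Since `m ≥ L ^ 2`, the error `θ √m` fits in the gap `m / L` between `l * m` and `θ ^ 2 * m`.
    have h1 : √m ≤ m * (1 / L) := by
      rw [mul_one_div, le_div_iff₀ hL0]
      calc √m * L ≤ √m * √m := by gcongr
        _ = m := Real.mul_self_sqrt hm1.le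
    have h2 : θ * √m < √m := mul_lt_of_lt_one_left (Real.sqrt_pos.2 hm1) hθ1'
    have h3 : (c / (1 + c) + 2 / L) * m = θ ^ 2 * m + m * (1 / L) := by
      rw [hθ2]
      ring
    linarith

open Filter in
lemma eventually_log_bounds (c : ℝ) : ∀ᶠ s : ℝ in atTop, 8 ≤ Real.log s ∧ 1 + c < Real.log s ∧
    12 * Real.log s ≤ √s ∧ 3 * Real.log s ^ 4 + 1 < s / 2 := by
  have h1 := Real.tendsto_log_atTop.eventually_ge_atTop 8
  have h2 := Real.tendsto_log_atTop.eventually_gt_atTop (1 + c)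
  have h3 := (isLittleO_log_rpow_atTop (r := 1 / 2) (by norm_num)).def
    (show (0 : ℝ) < 1 / 12 by norm_num)
  have h4 := (Real.isLittleO_pow_log_id_atTop (n := 4)).def (show (0 : ℝ) < 1 / 12 by norm_num)
  filter_upwards [h1, h2, h3, h4, eventually_gt_atTop 100] with s h1 h2 h3 h4 h5
  refine ⟨h1, h2, ?_, ?_⟩
  · rw [Real.norm_of_nonneg (by linarith), Real.norm_of_nonneg (by positivity),
      ← Real.sqrt_eq_rpow] at h3
    linarith
  · rw [Real.norm_of_nonneg (by positivity), id, Real.norm_of_nonneg (by positivity)] at h4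
    linarith

theorem mainTheorem7 :
    ∃ K : ℝ, 0 < K ∧ ∀ c : ℝ, 0 < c →
      ∃ c₁ c₂ s₀ : ℝ, 0 < c₁ ∧ 0 < c₂ ∧ 1 < s₀ ∧
        ∀ (s : ℝ), s₀ ≤ s → ∀ (d : ℕ) (X₁ X₂ : Set (EuclideanSpace ℝ (Fin d)))
          (μ₁ μ₂ : Measure (EuclideanSpace ℝ (Fin d))) (δ₁ δ₂ : ℝ),
          IsPacking s δ₁ X₁ μ₁ → IsInefficient c s X₁ →
          IsPacking s δ₂ X₂ μ₂ → IsInefficient c s X₂ →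
          ∃ X₁' ⊆ X₁,
            IsPacking s (δ₁ - K / Real.log s) X₁' μ₁ ∧
            IsSpread (c / (1 + c) * (1 + c₁ / Real.log s))
              (Real.exp (-c₂ * Real.log s ^ 2)) (X₁' ∪ -X₁') X₂ μ₂ := by
  refine ⟨1, one_pos, fun c hc => ?_⟩
  obtain ⟨s₀, hs₀⟩ := Filter.eventually_atTop.1 (eventually_log_bounds c)
  -- `c₁` is chosen so that `c / (1 + c) * c₁ = 2`; `K = 1` pays for two signs at cost `1 / (2 * log
  -- s)` each.
  refine ⟨2 * (1 + c) / c, 1, max s₀ 2, by positivity, one_pos,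
    lt_max_of_lt_right one_lt_two, ?_⟩
  intro s hs d X₁ X₂ μ₁ μ₂ δ₁ δ₂ h₁ hX₁ h₂ hX₂
  obtain ⟨h8, hcL, h12, h4⟩ := hs₀ s ((le_max_left _ _).trans hs)
  have hs1 : 1 < s := by linarith [(le_max_right s₀ 2).trans hs]
  have hheavy : ∀ ε : ℝ, |ε| = 1 → _ := fun ε hε =>
    h₁.measure_heavy_le hX₁ h₂ hX₂ hε hc hs1 h8 hcL h12 h4
  set L := Real.log s with hL
  have hL0 : 0 < L := by linarith
  have hl : c / (1 + c) * (1 + 2 * (1 + c) / c / L) = c / (1 + c) + 2 / L := by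
    field_simp
  rw [hl]
  set H : ℝ → Set (EuclideanSpace ℝ (Fin d)) := fun ε => {v ∈ X₁ | Real.exp (-L ^ 2) ≤
    μ₂.real {x ∈ X₂ | c / (1 + c) + 2 / L ≤ inner ℝ (ε • v) x}} with hH
  have hsmall : ∀ ε, ∀ v ∈ X₁, v ∉ H ε → μ₂ {x ∈ X₂ | c / (1 + c) + 2 / L ≤ inner ℝ (ε • v) x} ≤
      ENNReal.ofReal (Real.exp (-1 * L ^ 2)) := by
    intro ε v hv hvH
    have hlt : μ₂.real {x ∈ X₂ | c / (1 + c) + 2 / L ≤ inner ℝ (ε • v) x} < Real.exp (-L ^ 2) := by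
      by_contra! hcon
      exact hvH ⟨hv, hcon⟩
    rw [neg_one_mul]
    refine (ENNReal.le_ofReal_iff_toReal_le ?_ (Real.exp_pos _).le).2 hlt.le
    exact measure_ne_top_of_subset (Set.sep_subset _ _)
      (h₂.measure_le_one.trans_lt ENNReal.one_lt_top).ne
  refine ⟨X₁ \ (H 1 ∪ H (-1)), Set.sdiff_subset, ⟨fun x hx => h₁.norm_eq_one x hx.1,
    fun X' hX' => h₁.le_coverProb X' (hX'.trans Set.sdiff_subset), ?_⟩, ?_⟩
  · rw [ENNReal.ofReal_sub _ (by positivity), tsub_le_iff_right]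
    calc ENNReal.ofReal δ₁ ≤ μ₁ X₁ := h₁.le_measure
      _ ≤ μ₁ (X₁ \ (H 1 ∪ H (-1)) ∪ (H 1 ∪ H (-1))) :=
        measure_mono (by rw [Set.sdiff_union_self]; exact Set.subset_union_left)
      _ ≤ μ₁ (X₁ \ (H 1 ∪ H (-1))) + (μ₁ (H 1) + μ₁ (H (-1))) :=
        (measure_union_le _ _).trans (add_le_add_right (measure_union_le _ _) _)
      _ ≤ μ₁ (X₁ \ (H 1 ∪ H (-1))) +
          (ENNReal.ofReal (1 / (2 * L)) + ENNReal.ofReal (1 / (2 * L))) := by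
        gcongr
        · exact hheavy 1 (by simp)
        · exact hheavy (-1) (by simp)
      _ = _ := by
        rw [← ENNReal.ofReal_add (by positivity) (by positivity)]
        congr 2
        field_simp
        norm_num
  · rintro v (hv | hv)
    · simpa using hsmall 1 v hv.1 fun h => hv.2 (Or.inl h)
    · rw [Set.mem_neg] at hv
      simpa using hsmall (-1) (-v) hv.1 fun h => hv.2 (Or.inr h)
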